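/- Diffeological Cramér–Rao inequality. Let $k\in\{1,2,\dots\}\cup\{\infty\}$, let $\mathcal X$ be a measurable space, and let $\mathcal S(\mathcal X)$ be the Banach space of finite signed measures on $\mathcal X$ with the total variation norm. A $C^k$-diffeological statistical model $(P,\mathcal D)$ is a nonempty set $P$ of probability measures on $\mathcal X$ together with a $C^k$-diffeology $\mathcal D$ on $P$ (a set of maps $p:U\to P$, called plots, with $U\subseteq\mathbb R^n$ open and $n\ge 0$, which contains the constant maps on $\mathbb R^n$, is local, and is stable under composition with $C^k$-maps between open sets) such that every plot $p:U\to P\subset\mathcal S(\mathcal X)$ is a $C^k$-map. For $\xi\in P$, the tangent cone $C_\xi$ is the set of velocities $\dot c(0)\in\mathcal S(\mathcal X)$ of curves $c:\mathbb R\to P$ in $\mathcal D$ with $c(0)=\xi$, and $T_\xi$ is its linear hull; every $v\in T_\xi$ is dominated by $\xi$, and $\log v:=dv/d\xi$. The model is 2-integrable if $\log v\in L^2(\mathcal X,\xi)$ for all $\xi\in P$ and $v\in C_\xi$, and if, for every plot $p:U\to P$, the function $v\mapsto|dp(v)|_{\mathfrak g}$ is continuous on $TU$, where $\mathfrak g_\xi(v,w)=\int_{\mathcal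 X}\log v\,\log w\,d\xi$ is the Fisher metric. Let $T_\xi^{\mathfrak g}$ be the Hilbert space completion of $T_\xi$ with respect to $\mathfrak g_\xi$, and let $\langle\cdot,\cdot\rangle_{\mathfrak g^{-1}}$ be the inner product on its dual that makes the Riesz isomorphism $v\mapsto\langle v,\cdot\rangle_{\mathfrak g}$ isometric. Let $(P,\mathcal D)$ be a 2-integrable $C^k$-diffeological statistical model, $V$ a real locally convex topological vector space with topological dual $V'$, and $\varphi:P\to V$ a map. Let $\hat\sigma:\mathcal X\to P$ be a map such that $l\circ\varphi\circ\hat\sigma\in L^2(\mathcal X,\xi)$ for all $\xi\in P$ and $l\in V'$, and assume that $\hat\sigma$ is $\varphi$-regular: for every $l\in V'$ the function $\xi\mapsto\|l\circ\varphi\circ\hat\sigma\|_{L^2(\mathcal X,\xi)}$ is locally bounded on $P$ in the finest topology for which all plots are continuous (this holds in particular if it is locally bounded in the total variation topology). For $l\in V'$ put $\varphi^l_{\hat\sigma}(\xi)=\mathbb E_\xi(l\circ\varphi\circ\hat\sigma)$. Then for every $\xi\in P$ and $l\in V'$ the differential of $\varphi^l_{\hat\sigma}$ at $\xi$ exists and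 extends uniquely to a continuous linear functional $d\varphi^l_{\hat\sigma}(\xi)$ on $T^{\mathfrak g}_\xi$; that is, for every curve $c:\mathbb R\to P$ in $\mathcal D$ with $c(0)=\xi$, the function $\varphi^l_{\hat\sigma}\circ c$ is differentiable at $0$ with derivative $d\varphi^l_{\hat\sigma}(\xi)(\dot c(0))$. Moreover, the difference $$(l,m)\mapsto \mathbb E_\xi\big[(l\circ\varphi\circ\hat\sigma-\varphi^l_{\hat\sigma}(\xi))(m\circ\varphi\circ\hat\sigma-\varphi^m_{\hat\sigma}(\xi))\big]-\langle d\varphi^l_{\hat\sigma}(\xi),d\varphi^m_{\hat\sigma}(\xi)\rangle_{\mathfrak g^{-1}}$$ of the variance form and the inverse Fisher form $(\mathfrak g^\varphi_{\hat\sigma})^{-1}(\xi)$ is a positive semidefinite symmetric bilinear form on $V'$. -/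

import Mathlib

open MeasureTheory Set Filter Topology

noncomputable section

/-! ### The Banach space of finite signed measures with the total variation norm -/

section TotalVariation

variable {𝒳 : Type*} [MeasurableSpace 𝒳]

/-- The total variation norm `‖s‖ = |s|(𝒳)` of a finite signed measure. -/
instance SignedMeasure.instNormTV : Norm (SignedMeasure 𝒳) where
  norm s := (s.totalVariation univ).toReal

theorem SignedMeasure.norm_eq_totalVariation (s : SignedMeasure 𝒳) :
    ‖s‖ = (s.totalVariation univ).toReal := rfl

theorem SignedMeasure.normedSpaceCore : NormedSpace.Core ℝ (SignedMeasure 𝒳) where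
  norm_nonneg s := ENNReal.toReal_nonneg
  norm_smul c s := by
    simp only [SignedMeasure.norm_eq_totalVariation, SignedMeasure.totalVariation_eq_variation,
      VectorMeasure.variation_smul]
    simp
  norm_triangle s t := by
    have hs : s.variation univ ≠ ⊤ := by
      rw [← SignedMeasure.totalVariation_eq_variation]; exact measure_ne_top _ _
    have ht : t.variation univ ≠ ⊤ := by
      rw [← SignedMeasure.totalVariation_eq_variation]; exact measure_ne_top _ _
    simp only [SignedMeasure.norm_eq_totalVariation, SignedMeasure.totalVariation_eq_variation]
    rw [← ENNReal.toReal_add hs ht]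
    exact ENNReal.toReal_mono (ENNReal.add_ne_top.2 ⟨hs, ht⟩)
      (VectorMeasure.variation_add_le (μ := s) (ν := t) univ)
  norm_eq_zero_iff s := by
    have hs : s.variation univ ≠ ⊤ := by
      rw [← SignedMeasure.totalVariation_eq_variation]; exact measure_ne_top _ _
    simp only [SignedMeasure.norm_eq_totalVariation, SignedMeasure.totalVariation_eq_variation,
      ENNReal.toReal_eq_zero_iff, hs, or_false, Measure.measure_univ_eq_zero,
      VectorMeasure.variation_eq_zero]

instance SignedMeasure.instNormedAddCommGroupTV : NormedAddCommGroup (SignedMeasure 𝒳) :=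
  NormedAddCommGroup.ofCore SignedMeasure.normedSpaceCore

instance SignedMeasure.instNormedSpaceTV : NormedSpace ℝ (SignedMeasure 𝒳) :=
  NormedSpace.ofCore SignedMeasure.normedSpaceCore

end TotalVariation

/-! ### `C^k`-diffeologies -/

/-- A `C^k`-diffeology on `X`: a collection of maps (plots) `p : U → X` on open subsets `U ⊆ ℝⁿ`,
`n ≥ 0`.  A map `U → X` is represented by a function `p : ℝⁿ → X` whose values outside `U` are
irrelevant (`congr`). -/
structure CkDiffeology (k : ℕ∞) (X : Type*) where
  /-- `IsPlot U p`: the set `U` is open and `p` restricted to `U` belongs to the diffeology. -/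
  IsPlot : ∀ {n : ℕ}, Set (EuclideanSpace ℝ (Fin n)) → (EuclideanSpace ℝ (Fin n) → X) → Prop
  isOpen : ∀ {n : ℕ} {U : Set (EuclideanSpace ℝ (Fin n))} {p : EuclideanSpace ℝ (Fin n) → X},
    IsPlot U p → IsOpen U
  congr : ∀ {n : ℕ} {U : Set (EuclideanSpace ℝ (Fin n))} {p q : EuclideanSpace ℝ (Fin n) → X},
    IsPlot U p → EqOn p q U → IsPlot U q
  covering : ∀ (n : ℕ) (x : X), IsPlot (univ : Set (EuclideanSpace ℝ (Fin n))) (fun _ => x)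
  locality : ∀ {n : ℕ} {U : Set (EuclideanSpace ℝ (Fin n))} {p : EuclideanSpace ℝ (Fin n) → X},
    IsOpen U → (∀ r ∈ U, ∃ W, IsOpen W ∧ r ∈ W ∧ W ⊆ U ∧ IsPlot W p) → IsPlot U p
  comp : ∀ {m n : ℕ} {U : Set (EuclideanSpace ℝ (Fin n))} {p : EuclideanSpace ℝ (Fin n) → X}
    {W : Set (EuclideanSpace ℝ (Fin m))} {ψ : EuclideanSpace ℝ (Fin m) → EuclideanSpace ℝ (Fin n)},
    IsPlot U p → IsOpen W → ContDiffOn ℝ k ψ W → MapsTo ψ W U → IsPlot W (p ∘ ψ)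

namespace CkDiffeology

variable {k : ℕ∞} {X : Type*}

/-- `C^k`-curves `ℝ → X` of the diffeology (`ℝ` is identified with `ℝ¹`). -/
def IsCurve (D : CkDiffeology k X) (c : ℝ → X) : Prop :=
  D.IsPlot (univ : Set (EuclideanSpace ℝ (Fin 1))) (fun x => c (x 0))

/-- The D-topology: the finest topology on `X` for which all plots are continuous. -/
@[reducible] def dTopology (D : CkDiffeology k X) : TopologicalSpace X where
  IsOpen s := ∀ (n : ℕ) (U : Set (EuclideanSpace ℝ (Fin n))) (p : EuclideanSpace ℝ (Fin n) → X),
    D.IsPlot U p → IsOpen (U ∩ p ⁻¹' s)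
  isOpen_univ := fun n U p hp => by simpa using D.isOpen hp
  isOpen_inter := fun s t hs ht n U p hp => by
    have : U ∩ p ⁻¹' (s ∩ t) = (U ∩ p ⁻¹' s) ∩ (U ∩ p ⁻¹' t) := by
      ext x; simp only [mem_inter_iff, mem_preimage]; tauto
    rw [this]
    exact (hs n U p hp).inter (ht n U p hp)
  isOpen_sUnion := fun S hS n U p hp => by
    rw [preimage_sUnion, inter_iUnion₂]
    exact isOpen_biUnion fun s hs => hS s hs n U p hp

end CkDiffeology

/-! ### `C^k`-diffeological statistical models -/

/-- The inclusion of probability measures into the Banach space of finite signed measures. -/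
def toSigned {𝒳 : Type*} [MeasurableSpace 𝒳] (ξ : ProbabilityMeasure 𝒳) : SignedMeasure 𝒳 :=
  (ξ : Measure 𝒳).toSignedMeasure

/-- A `C^k`-diffeological statistical model `(P, 𝒟)`: a nonempty set `P` of probability measures on
`𝒳` with a `C^k`-diffeology all of whose plots are `C^k`-maps into the space of finite signed
measures with the total variation norm. -/
structure DiffeologicalStatisticalModel (k : ℕ∞) (𝒳 : Type*) [MeasurableSpace 𝒳] where
  carrier : Set (ProbabilityMeasure 𝒳)
  nonempty : carrier.Nonempty
  diffeology : CkDiffeology k carrier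
  contDiffOn_plot : ∀ {n : ℕ} {U : Set (EuclideanSpace ℝ (Fin n))}
    {p : EuclideanSpace ℝ (Fin n) → carrier}, diffeology.IsPlot U p →
    ContDiffOn ℝ k (fun x => toSigned (p x).1) U

namespace DiffeologicalStatisticalModel

variable {k : ℕ∞} {𝒳 : Type*} [MeasurableSpace 𝒳] (M : DiffeologicalStatisticalModel k 𝒳)

/-- The point `ξ ∈ P` as a measure on `𝒳`. -/
abbrev meas {M : DiffeologicalStatisticalModel k 𝒳} (ξ : M.carrier) : Measure 𝒳 :=
  (ξ.1 : Measure 𝒳)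

/-- `v` is the velocity at time `0` (in the total variation norm) of the curve `c` in `P`. -/
def HasVelocity {M : DiffeologicalStatisticalModel k 𝒳} (c : ℝ → M.carrier)
    (v : SignedMeasure 𝒳) : Prop :=
  HasDerivAt (fun t => toSigned (c t).1) v 0

/-- The tangent cone `C_ξ(P, 𝒟)`. -/
def tangentCone (ξ : M.carrier) : Set (SignedMeasure 𝒳) :=
  {v | ∃ c : ℝ → M.carrier, M.diffeology.IsCurve c ∧ c 0 = ξ ∧ HasVelocity c v}

/-- The tangent space `T_ξ(P, 𝒟)`, the linear hull of the tangent cone. -/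
def tangentSpace (ξ : M.carrier) : Submodule ℝ (SignedMeasure 𝒳) :=
  Submodule.span ℝ (M.tangentCone ξ)

/-- Tangent vectors at `ξ` are dominated by `ξ`. -/
theorem apply_eq_zero_of_mem_tangentSpace (ξ : M.carrier) {v : SignedMeasure 𝒳}
    (hv : v ∈ M.tangentSpace ξ) {A : Set 𝒳} (hA : MeasurableSet A) (h0 : meas ξ A = 0) :
    v A = 0 := by
  induction hv using Submodule.span_induction with
  | zero => simp
  | add v w _ _ hv hw => simp [hv, hw]
  | smul a v _ hv => simp [hv]
  | mem v hv =>
    obtain ⟨c, -, rfl, hc⟩ := hv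
    let e : SignedMeasure 𝒳 →L[ℝ] ℝ := LinearMap.mkContinuous
      { toFun := fun s => s A, map_add' := fun s t => by simp, map_smul' := fun a s => by simp } 1
      (fun s => by
        rw [one_mul]
        exact (SignedMeasure.norm_le_totalVariation s A).trans
          (ENNReal.toReal_mono (measure_ne_top _ _) (measure_mono (subset_univ A))))
    have hd : HasDerivAt (fun t => toSigned (c t).1 A) (v A) 0 :=
      e.hasFDerivAt.comp_hasDerivAt (0 : ℝ) hc
    have hval : ∀ t, toSigned (c t).1 A = (meas (c t)).real A := fun t =>
      Measure.toSignedMeasure_apply_measurable hA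
    refine IsLocalMin.hasDerivAt_eq_zero (Eventually.of_forall fun t => ?_) hd
    simp only [hval]
    rw [measureReal_def (μ := meas (c 0)), h0]
    exact measureReal_nonneg

/-- The logarithmic representation `log v = dv/dξ` of `v`, the Radon–Nikodym derivative. -/
def logRep {M : DiffeologicalStatisticalModel k 𝒳} (ξ : M.carrier) (v : SignedMeasure 𝒳) : 𝒳 → ℝ :=
  v.rnDeriv (meas ξ)

/-- `(P, 𝒟)` is almost 2-integrable: `log (C_ξ(P, 𝒟)) ⊆ L²(𝒳, ξ)` for all `ξ ∈ P`. -/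
def IsAlmost2Integrable : Prop :=
  ∀ ξ : M.carrier, ∀ v ∈ M.tangentCone ξ, MemLp (logRep ξ v) 2 (meas ξ)

/-- The Fisher metric `𝔤_ξ(v, w) = ∫ log v · log w dξ`. -/
def fisherMetric (ξ : M.carrier) (v w : SignedMeasure 𝒳) : ℝ :=
  ∫ x, logRep ξ v x * logRep ξ w x ∂(meas ξ)

/-- `(P, 𝒟)` is 2-integrable: it is almost 2-integrable and, for every plot `p : U → P`, the
function `v ↦ |dp(v)|_𝔤` is continuous on `TU = U × ℝⁿ`. -/
structure Is2Integrable : Prop where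
  almost : M.IsAlmost2Integrable
  continuousOn_norm : ∀ (n : ℕ) (U : Set (EuclideanSpace ℝ (Fin n)))
    (p : EuclideanSpace ℝ (Fin n) → M.carrier), M.diffeology.IsPlot U p →
    ContinuousOn (fun z : EuclideanSpace ℝ (Fin n) × EuclideanSpace ℝ (Fin n) =>
      √(M.fisherMetric (p z.1) (fderiv ℝ (fun x => toSigned (p x).1) z.1 z.2)
        (fderiv ℝ (fun x => toSigned (p x).1) z.1 z.2))) (U ×ˢ univ)

variable {M}

theorem memLp_logRep (h : M.IsAlmost2Integrable) (ξ : M.carrier) (v : M.tangentSpace ξ) :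
    MemLp (logRep ξ v.1) 2 (meas ξ) := by
  obtain ⟨v, hv⟩ := v
  induction hv using Submodule.span_induction with
  | mem v hv => exact h ξ v hv
  | zero =>
    have := SignedMeasure.rnDeriv_smul (0 : SignedMeasure 𝒳) (meas ξ) 0
    rw [zero_smul, zero_smul] at this
    exact (MemLp.zero' (ε := ℝ)).ae_eq this.symm
  | add v w _ _ hv hw =>
    exact (hv.add hw).ae_eq (SignedMeasure.rnDeriv_add v w (meas ξ)).symm
  | smul a v _ hv =>
    exact (hv.const_smul a).ae_eq (SignedMeasure.rnDeriv_smul v (meas ξ) a).symm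

/-- The logarithmic representation `T_ξ(P, 𝒟) → L²(𝒳, ξ)`; by definition of the Fisher metric it
is isometric. -/
def logL2 (h : M.IsAlmost2Integrable) (ξ : M.carrier) :
    M.tangentSpace ξ →ₗ[ℝ] Lp ℝ 2 (meas ξ) where
  toFun v := (memLp_logRep h ξ v).toLp _
  map_add' v w := by
    rw [← MemLp.toLp_add]
    exact MemLp.toLp_congr _ _ (SignedMeasure.rnDeriv_add v.1 w.1 (meas ξ))
  map_smul' a v := by
    rw [RingHom.id_apply, ← MemLp.toLp_const_smul]
    exact MemLp.toLp_congr _ _ (SignedMeasure.rnDeriv_smul v.1 (meas ξ) a)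

/-- The completion `T_ξ^𝔤(P, 𝒟)` of `T_ξ(P, 𝒟)` with respect to the Fisher metric, realised as the
closure of `log T_ξ(P, 𝒟)` in `L²(𝒳, ξ)`. -/
def fisherCompletion (h : M.IsAlmost2Integrable) (ξ : M.carrier) :
    Submodule ℝ (Lp ℝ 2 (meas ξ)) :=
  (LinearMap.range (logL2 h ξ)).topologicalClosure

instance (h : M.IsAlmost2Integrable) (ξ : M.carrier) : CompleteSpace (fisherCompletion h ξ) :=
  inferInstanceAs (CompleteSpace (LinearMap.range (logL2 h ξ)).topologicalClosure)

/-- The canonical map `T_ξ(P, 𝒟) → T_ξ^𝔤(P, 𝒟)` into the completion. -/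
def toCompletion (h : M.IsAlmost2Integrable) (ξ : M.carrier) :
    M.tangentSpace ξ →ₗ[ℝ] fisherCompletion h ξ :=
  (logL2 h ξ).codRestrict _ fun v =>
    Submodule.le_topologicalClosure _ (LinearMap.mem_range_self _ v)

/-- The canonical map into the completion is isometric for the Fisher metric. -/
theorem inner_toCompletion (h : M.IsAlmost2Integrable) (ξ : M.carrier) (v w : M.tangentSpace ξ) :
    inner ℝ (toCompletion h ξ v) (toCompletion h ξ w) = M.fisherMetric ξ v.1 w.1 := by
  change inner ℝ (logL2 h ξ v) (logL2 h ξ w) = _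
  rw [L2.inner_def]
  refine integral_congr_ae ?_
  filter_upwards [(memLp_logRep h ξ v).coeFn_toLp, (memLp_logRep h ξ w).coeFn_toLp] with x hv hw
  change inner ℝ ((memLp_logRep h ξ v).toLp _ x) ((memLp_logRep h ξ w).toLp _ x) = _
  rw [hv, hw]
  simp [mul_comm]

/-- The canonical map into the completion has dense range. -/
theorem denseRange_toCompletion (h : M.IsAlmost2Integrable) (ξ : M.carrier) :
    DenseRange (toCompletion h ξ) := by
  intro u
  rw [Topology.IsInducing.subtypeVal.closure_eq_preimage_closure_image]
  have : ((fun u : fisherCompletion h ξ => (u : Lp ℝ 2 (meas ξ))) '' range (toCompletion h ξ)) =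
      (LinearMap.range (logL2 h ξ) : Set (Lp ℝ 2 (meas ξ))) := by
    rw [← range_comp]; rfl
  have hu : (u : Lp ℝ 2 (meas ξ)) ∈
      closure (LinearMap.range (logL2 h ξ) : Set (Lp ℝ 2 (meas ξ))) := u.2
  rw [← this] at hu
  exact hu

/-- The inverse `𝔤⁻¹` of the Fisher metric on the dual of the Hilbert space `T_ξ^𝔤(P, 𝒟)`:
`⟨L v, L w⟩ = ⟨v, w⟩_𝔤`, where `L v = ⟨v, ·⟩_𝔤`. -/
def inverseFisher (h : M.IsAlmost2Integrable) (ξ : M.carrier)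
    (α β : StrongDual ℝ (fisherCompletion h ξ)) : ℝ :=
  inner ℝ ((InnerProductSpace.toDual ℝ (fisherCompletion h ξ)).symm α)
    ((InnerProductSpace.toDual ℝ (fisherCompletion h ξ)).symm β)

/-- `df(ξ)` extends to the element `α` of the dual of `T_ξ^𝔤(P, 𝒟)`: for every `C^k`-curve `c` in
`𝒟` with `c(0) = ξ` and velocity `v = ċ(0)`, the function `f ∘ c` is differentiable at `0` with
derivative `α(v)`. -/
def HasDifferentialAt (h : M.IsAlmost2Integrable) (f : M.carrier → ℝ) (ξ : M.carrier)
    (α : StrongDual ℝ (fisherCompletion h ξ)) : Prop :=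
  ∀ (c : ℝ → M.carrier) (v : M.tangentSpace ξ), M.diffeology.IsCurve c → c 0 = ξ →
    HasVelocity c v.1 → HasDerivAt (fun t => f (c t)) (α (toCompletion h ξ v)) 0

open Classical in
/-- The differential `df(ξ)` as an element of the dual of `T_ξ^𝔤(P, 𝒟)` (and `0` if `df(ξ)` does
not extend to such an element). -/
def differential (h : M.IsAlmost2Integrable) (f : M.carrier → ℝ) (ξ : M.carrier) :
    StrongDual ℝ (fisherCompletion h ξ) :=
  if hα : ∃ α, HasDifferentialAt h f ξ α then hα.choose else 0

/-! ### Estimators -/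

section Estimator

variable {V : Type*} [AddCommGroup V] [Module ℝ V] [TopologicalSpace V]

/-- `σ ∈ L²_φ(𝒳, P)`: `l ∘ φ ∘ σ ∈ L²(𝒳, ξ)` for all `ξ ∈ P` and all `l ∈ V'`. -/
def MemL2 (φ : M.carrier → V) (σ : 𝒳 → M.carrier) : Prop :=
  ∀ (ξ : M.carrier) (l : StrongDual ℝ V), MemLp (fun x => l (φ (σ x))) 2 (meas ξ)

/-- The `φ`-mean value `φ_σ(ξ)(l) = 𝔼_ξ(l ∘ φ ∘ σ)`. -/
def meanValue (φ : M.carrier → V) (σ : 𝒳 → M.carrier) (l : StrongDual ℝ V) (ξ : M.carrier) : ℝ :=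
  ∫ x, l (φ (σ x)) ∂(meas ξ)

/-- The variance quadratic form of the `φ`-estimator `φ ∘ σ` at `ξ`. -/
def varianceForm (φ : M.carrier → V) (σ : 𝒳 → M.carrier) (ξ : M.carrier)
    (l m : StrongDual ℝ V) : ℝ :=
  ∫ x, (l (φ (σ x)) - meanValue φ σ l ξ) * (m (φ (σ x)) - meanValue φ σ m ξ) ∂(meas ξ)

/-- `σ` is `φ`-regular: for all `l ∈ V'` the function `ξ ↦ ‖l ∘ φ ∘ σ‖_{L²(𝒳, ξ)}` is locally
bounded on `P`.  Neighbourhoods are those of the D-topology, which is finer than the topology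
induced by the total variation norm, see `isRegular_of_tv`. -/
def IsRegular (φ : M.carrier → V) (σ : 𝒳 → M.carrier) : Prop :=
  ∀ (l : StrongDual ℝ V) (ξ₀ : M.carrier), ∃ C : NNReal,
    ∀ᶠ ξ in @nhds M.carrier M.diffeology.dTopology ξ₀,
      eLpNorm (fun x => l (φ (σ x))) 2 (meas ξ) ≤ C

/-- Local boundedness in the total variation topology implies regularity. -/
theorem isRegular_of_tv (φ : M.carrier → V) (σ : 𝒳 → M.carrier)
    (h : ∀ (l : StrongDual ℝ V) (ξ₀ : M.carrier), ∃ C : NNReal,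
      ∀ᶠ ξ in comap (fun ξ : M.carrier => toSigned ξ.1) (𝓝 (toSigned ξ₀.1)),
        eLpNorm (fun x => l (φ (σ x))) 2 (meas ξ) ≤ C) : IsRegular φ σ := by
  intro l ξ₀
  obtain ⟨C, hC⟩ := h l ξ₀
  refine ⟨C, Filter.Eventually.filter_mono ?_ hC⟩
  rw [← tendsto_iff_comap]
  have hcont : @Continuous _ _ M.diffeology.dTopology _
      (fun ξ : M.carrier => toSigned ξ.1) := by
    refine @Continuous.mk _ _ M.diffeology.dTopology _ _ fun s hs n U p hp => ?_
    exact (M.contDiffOn_plot hp).continuousOn.isOpen_inter_preimage (M.diffeology.isOpen hp) hs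
  exact @Continuous.tendsto _ _ M.diffeology.dTopology _ _ hcont ξ₀

/-- The quadratic form `(𝔤^φ_σ)⁻¹(ξ)(l, m) = ⟨dφ_σ^l, dφ_σ^m⟩_{𝔤⁻¹}(ξ)` on `V'`. -/
def inverseFisherForm (h : M.IsAlmost2Integrable) (φ : M.carrier → V) (σ : 𝒳 → M.carrier)
    (ξ : M.carrier) (l m : StrongDual ℝ V) : ℝ :=
  inverseFisher h ξ (differential h (meanValue φ σ l) ξ) (differential h (meanValue φ σ m) ξ)

end Estimator

end DiffeologicalStatisticalModel

end

open MeasureTheory Set Filter Topology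

noncomputable section

/-! The theorem combines an analytic fact with a Hilbert space fact. Analytic: along a curve of
measures `μ s` with scores `L s`, the integral of `f` has derivative `∫ f L t dμ t` at `t` when the
second moments of `f` are bounded near `t` (`hasDerivAt_integral_of_continuousAt_integral_sq`). For
simple functions this follows from setwise differentiability. For general `f` the derivatives `∫ g L
s dμ s` of simple approximations `g` must be controlled uniformly in `g` and in `s` near `t`.
Continuity of the Fisher norm supplies this: a simple `h` close to `L t` in mean square stays close
to `L s` in `L²(μ s)` for nearby `s`. The mean value inequality then carries the estimate from `g`
to `f`. Hilbert space: scores have mean zero, so the derivative is the inner product of the score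
with the centred estimator in `L²(ξ)`. The differential is therefore represented by the orthogonal
projection of the centred estimator onto the completed tangent space
(`Is2Integrable.hasDifferentialAt_meanValue`). The variance form is the Gram form of the centred
estimators, the inverse Fisher form that of their projections, and projection does not increase
norms. -/

namespace MeasureTheory

/-! ### Approximation by simple functions. -/

variable {𝒳 : Type*} [MeasurableSpace 𝒳]

/-- A measurable real function is approximated by simple functions, up to an error controlled by
its square. -/
theorem exists_simpleFunc_abs_sub_le {f : 𝒳 → ℝ} (hf : Measurable f) {ε : ℝ} (hε : 0 < ε) :
    ∃ g : SimpleFunc 𝒳 ℝ, (∀ x, |g x| ≤ |f x| + 1) ∧ ∀ x, |g x - f x| ≤ ε * (1 + f x ^ 2) := by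
  classical
  obtain ⟨n, hn⟩ := exists_nat_one_div_lt hε
  set N : ℝ := n + 1 with hN
  have hN1 : 1 ≤ N := by simp [hN]
  have hN0 : 0 < N := by linarith
  have hεN : 1 ≤ ε * N := by
    rw [div_lt_iff₀ hN0] at hn
    exact hn.le
  -- Round down to multiples of `1/N` where `|f| ≤ N`, and cut off elsewhere. On the cut-off part
  -- the error is `|f| ≤ f²/N ≤ ε f²`.
  set g : 𝒳 → ℝ := fun x => if |f x| ≤ N then (⌊N * f x⌋ : ℝ) / N else 0 with hg
  have hgm : Measurable g := by
    refine Measurable.ite (measurableSet_le (by fun_prop) measurable_const) ?_ measurable_const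
    have : Measurable fun x => (⌊N * f x⌋ : ℝ) :=
      (measurable_from_top (f := fun z : ℤ => (z : ℝ))).comp
        (Int.measurable_floor.comp (hf.const_mul N))
    exact this.div_const N
  have hfin : (range g).Finite := by
    refine Set.Finite.subset (((Set.finite_Icc ⌊-(N * N)⌋ ⌊N * N⌋).image
      (fun z : ℤ => (z : ℝ) / N)).union (Set.finite_singleton 0)) ?_
    rintro _ ⟨x, rfl⟩
    by_cases hx : |f x| ≤ N
    · left
      obtain ⟨h1, h2⟩ := abs_le.1 hx
      refine ⟨⌊N * f x⌋, ⟨Int.floor_le_floor ?_, Int.floor_le_floor ?_⟩, by simp [hg, hx]⟩ <;>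
        nlinarith
    · right
      simp [hg, hx]
  have key : ∀ x, |f x| ≤ N → |g x - f x| ≤ 1 / N := by
    intro x hx
    have h1 := Int.floor_le (N * f x)
    have h2 := Int.lt_floor_add_one (N * f x)
    have : g x - f x = (⌊N * f x⌋ - N * f x) / N := by
      simp only [hg, hx, if_true]
      field_simp
    rw [this, abs_div, abs_of_pos hN0]
    gcongr
    rw [abs_le]
    constructor <;> linarith
  have hN' : 1 / N ≤ ε := by rw [div_le_iff₀ hN0]; exact hεN
  refine ⟨⟨g, fun y => hgm (measurableSet_singleton y), hfin⟩, fun x => ?_, fun x => ?_⟩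
  · change |g x| ≤ _
    by_cases hx : |f x| ≤ N
    · have h3 := key x hx
      have h4 : 1 / N ≤ 1 := by rw [div_le_one hN0]; exact hN1
      have h5 := abs_sub_abs_le_abs_sub (g x) (f x)
      linarith
    · simp only [hg, hx, if_false, abs_zero]
      positivity
  · change |g x - f x| ≤ _
    by_cases hx : |f x| ≤ N
    · refine (key x hx).trans (hN'.trans ?_)
      nlinarith [sq_nonneg (f x)]
    · simp only [hg, hx, if_false, zero_sub, abs_neg]
      rw [← sq_abs]
      nlinarith [abs_nonneg (f x), mul_le_mul_of_nonneg_left hεN (abs_nonneg (f x)),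
        mul_le_mul_of_nonneg_left (not_le.1 hx).le (mul_nonneg hε.le (abs_nonneg (f x)))]

theorem abs_integral_mul_le_sqrt {μ : Measure 𝒳} {f g : 𝒳 → ℝ} (hf : MemLp f 2 μ)
    (hg : MemLp g 2 μ) :
    |∫ x, f x * g x ∂μ| ≤ √(∫ x, f x ^ 2 ∂μ) * √(∫ x, g x ^ 2 ∂μ) := by
  have hnorm : ∀ {u : 𝒳 → ℝ} (hu : MemLp u 2 μ), ‖hu.toLp u‖ = √(∫ x, u x ^ 2 ∂μ) := by
    intro u hu
    rw [norm_eq_sqrt_real_inner, L2.inner_def]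
    congr 1
    refine integral_congr_ae ?_
    filter_upwards [hu.coeFn_toLp] with x hx
    simp [hx, sq]
  rw [← hnorm hf, ← hnorm hg]
  convert abs_real_inner_le_norm (hf.toLp f) (hg.toLp g) using 2
  rw [L2.inner_def]
  refine integral_congr_ae ?_
  filter_upwards [hf.coeFn_toLp, hg.coeFn_toLp] with x hx hy
  simp [hx, hy, mul_comm]

theorem exists_simpleFunc_integral_sq_sub_lt {μ : Measure 𝒳} {f : 𝒳 → ℝ} (hf : MemLp f 2 μ)
    {ε : ℝ} (hε : 0 < ε) :
    ∃ h : SimpleFunc 𝒳 ℝ, MemLp h 2 μ ∧ ∫ x, (f x - h x) ^ 2 ∂μ < ε ^ 2 := by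
  obtain ⟨h, h1, h2⟩ := hf.exists_simpleFunc_eLpNorm_sub_lt (by simp)
    (ε := ENNReal.ofReal ε) (by simpa using hε)
  refine ⟨h, h2, ?_⟩
  have h3 : MemLp (f - ⇑h) 2 μ := hf.sub h2
  have h4 : (eLpNorm (f - ⇑h) 2 μ).toReal < ε :=
    (ENNReal.toReal_lt_of_lt_ofReal h1)
  have h5 : ∫ x, (f x - h x) ^ 2 ∂μ = (eLpNorm (f - ⇑h) 2 μ).toReal ^ 2 := by
    rw [h3.eLpNorm_eq_integral_rpow_norm (by simp) (by simp), ENNReal.toReal_ofReal (by positivity)]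
    have h0 : 0 ≤ ∫ x, (f x - h x) ^ 2 ∂μ := integral_nonneg fun x => sq_nonneg _
    simp only [ENNReal.toReal_ofNat, Real.rpow_ofNat, Pi.sub_apply, Real.norm_eq_abs, sq_abs]
    rw [← Real.rpow_natCast, ← Real.rpow_mul h0]
    norm_num
  rw [h5]
  exact pow_lt_pow_left₀ h4 ENNReal.toReal_nonneg (by simp)

/-- With finitely many set integrals, setwise continuity and differentiability in a parameter pass
to integrals against simple functions, even when the measure varies too. -/
theorem integral_simpleFunc_mul {μ : Measure 𝒳} (h : SimpleFunc 𝒳 ℝ) {φ : 𝒳 → ℝ}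
    (hφ : Integrable φ μ) :
    ∫ x, h x * φ x ∂μ = ∑ y ∈ h.range, y * ∫ x in h ⁻¹' {y}, φ x ∂μ := by
  classical
  have hx : ∀ x, h x * φ x = ∑ y ∈ h.range, y * (h ⁻¹' {y}).indicator φ x := by
    intro x
    rw [Finset.sum_eq_single (h x)]
    · simp
    · intro y _ hy
      simp [indicator, Ne.symm hy]
    · intro hx
      exact absurd (h.mem_range_self x) hx
  simp_rw [hx]
  rw [integral_finsetSum]
  · refine Finset.sum_congr rfl fun y _ => ?_
    rw [integral_const_mul, integral_indicator (h.measurableSet_fiber y)]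
  · exact fun y _ => (hφ.indicator (h.measurableSet_fiber y)).const_mul y

theorem integrable_simpleFunc_mul {μ : Measure 𝒳} (h : SimpleFunc 𝒳 ℝ) {φ : 𝒳 → ℝ}
    (hφ : Integrable φ μ) : Integrable (fun x => h x * φ x) μ := by
  obtain ⟨C, hC⟩ := h.exists_forall_norm_le
  exact hφ.bdd_mul h.measurable.aestronglyMeasurable (Eventually.of_forall hC)

theorem continuousAt_integral_simpleFunc_mul {μ : ℝ → Measure 𝒳} {L : ℝ → 𝒳 → ℝ} {t : ℝ}
    (hL : ∀ s, Integrable (L s) (μ s))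
    (hv : ∀ A, MeasurableSet A → ContinuousAt (fun s => ∫ x in A, L s x ∂μ s) t)
    (h : SimpleFunc 𝒳 ℝ) : ContinuousAt (fun s => ∫ x, h x * L s x ∂μ s) t := by
  simp_rw [fun s => integral_simpleFunc_mul h (hL s)]
  exact tendsto_finsetSum _ fun y _ => (hv _ (h.measurableSet_fiber y)).const_mul y

/-! ### Differentiation under the integral along a curve of measures. -/

section Curve

variable {μ : ℝ → Measure 𝒳} [∀ t, IsProbabilityMeasure (μ t)] {L : ℝ → 𝒳 → ℝ}

theorem hasDerivAt_integral_simpleFunc {t : ℝ} (hL : Integrable (L t) (μ t))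
    (hμ : ∀ A, MeasurableSet A → HasDerivAt (fun s => (μ s).real A) (∫ x in A, L t x ∂μ t) t)
    (h : SimpleFunc 𝒳 ℝ) :
    HasDerivAt (fun s => ∫ x, h x ∂μ s) (∫ x, h x * L t x ∂μ t) t := by
  rw [integral_simpleFunc_mul h hL]
  have h1 : ∀ s, ∫ x, h x ∂μ s = ∑ y ∈ h.range, y * (μ s).real (h ⁻¹' {y}) := by
    intro s
    have := integral_simpleFunc_mul (μ := μ s) h (integrable_const (1 : ℝ))
    simpa using this
  simp_rw [h1]
  exact HasDerivAt.fun_sum fun y _ => (hμ _ (h.measurableSet_fiber y)).const_mul y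

/-- If the Fisher norm of the velocities is continuous, the scores near `t` are approximated in
mean square, uniformly, by a simple function. -/
theorem exists_simpleFunc_eventually_integral_sq_sub_lt {t : ℝ}
    (hL : ∀ s, MemLp (L s) 2 (μ s))
    (hμ : ∀ A, MeasurableSet A → HasDerivAt (fun s => (μ s).real A) (∫ x in A, L t x ∂μ t) t)
    (hv : ∀ A, MeasurableSet A → ContinuousAt (fun s => ∫ x in A, L s x ∂μ s) t)
    (hn : ContinuousAt (fun s => ∫ x, L s x * L s x ∂μ s) t) {ε : ℝ} (hε : 0 < ε) :
    ∃ h : SimpleFunc 𝒳 ℝ, ∀ᶠ s in 𝓝 t, ∫ x, (L s x - h x) ^ 2 ∂μ s < ε ^ 2 := by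
  have hLi : ∀ s, Integrable (L s) (μ s) := fun s => (hL s).integrable (by norm_num)
  obtain ⟨h, -, hh⟩ := exists_simpleFunc_integral_sq_sub_lt (hL t) hε
  refine ⟨h, ?_⟩
  -- In the expanded square the first term is continuous by `hn`, the other two because `h` is
  -- simple. A strict bound at `t` thus persists nearby.
  have h1 : ∀ s, ∫ x, (L s x - h x) ^ 2 ∂μ s =
      ∫ x, L s x * L s x ∂μ s - 2 * ∫ x, h x * L s x ∂μ s + ∫ x, (h * h) x ∂μ s := by
    intro s
    have i1 : Integrable (fun x => L s x * L s x) (μ s) := (hL s).integrable_mul (hL s)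
    have i2 := (integrable_simpleFunc_mul h (hLi s)).const_mul 2
    have i3 : Integrable (h * h) (μ s) := SimpleFunc.integrable_of_isFiniteMeasure _
    rw [← integral_const_mul, ← integral_sub i1 i2, ← integral_add (by exact i1.sub i2) i3]
    refine integral_congr_ae (Eventually.of_forall fun x => ?_)
    simp only [SimpleFunc.coe_mul, Pi.mul_apply]
    ring
  have hcont : ContinuousAt (fun s => ∫ x, (L s x - h x) ^ 2 ∂μ s) t := by
    simp_rw [h1]
    exact (hn.sub ((continuousAt_integral_simpleFunc_mul hLi hv h).const_mul 2)).add
      (hasDerivAt_integral_simpleFunc (hLi t) hμ (h * h)).continuousAt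
  exact hcont.eventually (gt_mem_nhds hh)

/-- Differentiation of `∫ f dμₛ` tested on simple approximations of `f`: their derivatives are
uniformly close to `∫ f L dμₜ`. -/
theorem eventually_abs_integral_mul_sub_le {t : ℝ}
    (hL : ∀ s, MemLp (L s) 2 (μ s))
    (hμ : ∀ A, MeasurableSet A → HasDerivAt (fun s => (μ s).real A) (∫ x in A, L t x ∂μ t) t)
    (hv : ∀ A, MeasurableSet A → ContinuousAt (fun s => ∫ x in A, L s x ∂μ s) t)
    (hn : ContinuousAt (fun s => ∫ x, L s x * L s x ∂μ s) t)
    {f : 𝒳 → ℝ} (hfm : Measurable f) (hf : ∀ s, MemLp f 2 (μ s)) {D : ℝ}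
    (hD : ∀ᶠ s in 𝓝 t, ∫ x, f x ^ 2 ∂μ s ≤ D) {η : ℝ} (hη : 0 < η) :
    ∃ δ > 0, ∀ᶠ s in 𝓝 t, ∀ g : SimpleFunc 𝒳 ℝ, (∀ x, |g x| ≤ |f x| + 1) →
      (∀ x, |g x - f x| ≤ δ * (1 + f x ^ 2)) →
      |∫ x, g x * L s x ∂μ s - ∫ x, f x * L t x ∂μ t| ≤ η := by
  have hLi : ∀ s, Integrable (L s) (μ s) := fun s => (hL s).integrable (by norm_num)
  have hD0 : 0 ≤ D := (integral_nonneg fun x => sq_nonneg _).trans hD.self_of_nhds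
  have hfsq : ∀ s, Integrable (fun x => f x ^ 2) (μ s) := fun s => (hf s).integrable_sq
  -- Bounds `∫ u²` whenever `|u| ≤ |f| + 1`, since `(|f| + 1)² ≤ 2 f² + 2`.
  set E : ℝ := 2 * D + 2 with hE
  have hE0 : 0 < √E := Real.sqrt_pos.2 (by positivity)
  obtain ⟨h, hh⟩ := exists_simpleFunc_eventually_integral_sq_sub_lt hL hμ hv hn
    (ε := η / (8 * √E)) (by positivity)
  have hhL : ∀ s, MemLp (fun x => L s x - h x) 2 (μ s) := fun s =>
    (hL s).sub (h.memLp_of_isFiniteMeasure 2 _)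
  obtain ⟨H, hH⟩ : ∃ H : ℝ, ∀ x, |h x| ≤ H := h.exists_forall_norm_le
  set δ : ℝ := η / (8 * E * (|H| + 1)) with hδ
  have hδ0 : 0 < δ := by positivity
  have hHδ : |H| * (δ * E) ≤ η / 8 := by
    rw [hδ, ← sub_nonneg]
    have hE1 : 0 < E := by positivity
    have : η / 8 - |H| * (η / (8 * E * (|H| + 1)) * E) = η / (8 * (|H| + 1)) := by
      field_simp
      ring
    rw [this]
    positivity
  -- One fixed approximation `g₀` serves the passage from `s` to `t`, so the neighbourhood of `t`
  -- does not depend on `g`.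
  obtain ⟨g₀, hg₀, hg₀'⟩ := exists_simpleFunc_abs_sub_le hfm hδ0
  -- square-integrable functions dominated by `|f| + 1`, tested against `L - h`
  have cs : ∀ s, ∫ x, f x ^ 2 ∂μ s ≤ D → ∫ x, (L s x - h x) ^ 2 ∂μ s < (η / (8 * √E)) ^ 2 →
      ∀ u : 𝒳 → ℝ, MemLp u 2 (μ s) → (∀ x, |u x| ≤ |f x| + 1) →
      |∫ x, u x * L s x ∂μ s - ∫ x, u x * h x ∂μ s| ≤ η / 8 := by
    intro s h1 h2 u hu hub
    have i1 : Integrable (fun x => u x * L s x) (μ s) := hu.integrable_mul (hL s)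
    have i2 : Integrable (fun x => u x * h x) (μ s) :=
      hu.integrable_mul (h.memLp_of_isFiniteMeasure 2 _)
    rw [← integral_sub i1 i2]
    simp_rw [← mul_sub]
    refine (abs_integral_mul_le_sqrt hu (hhL s)).trans ?_
    have h3 : ∫ x, u x ^ 2 ∂μ s ≤ E := by
      calc ∫ x, u x ^ 2 ∂μ s ≤ ∫ x, (2 * f x ^ 2 + 2) ∂μ s := by
            refine integral_mono hu.integrable_sq
              (((hfsq s).const_mul 2).add (integrable_const 2)) fun x => ?_
            have := hub x
            simp only
            nlinarith [sq_nonneg (|f x| - 1), sq_abs (f x), sq_abs (u x), abs_nonneg (u x),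
              abs_nonneg (f x)]
        _ = 2 * ∫ x, f x ^ 2 ∂μ s + 2 := by
            rw [integral_add ((hfsq s).const_mul 2) (integrable_const 2), integral_const_mul]
            simp
        _ ≤ E := by linarith
    calc √(∫ x, u x ^ 2 ∂μ s) * √(∫ x, (L s x - h x) ^ 2 ∂μ s)
        ≤ √E * (η / (8 * √E)) := by
          gcongr
          exact Real.sqrt_le_iff.2 ⟨by positivity, h2.le⟩
      _ = η / 8 := by field_simp
  -- replacing a simple approximation of `f` by `f`, tested against `h`
  have ap : ∀ s, ∫ x, f x ^ 2 ∂μ s ≤ D → ∀ g : SimpleFunc 𝒳 ℝ,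
      (∀ x, |g x - f x| ≤ δ * (1 + f x ^ 2)) →
      |∫ x, g x * h x ∂μ s - ∫ x, f x * h x ∂μ s| ≤ η / 8 := by
    intro s h1 g hg
    have i1 : Integrable (fun x => g x * h x) (μ s) :=
      (g.memLp_of_isFiniteMeasure 2 _).integrable_mul (h.memLp_of_isFiniteMeasure 2 _)
    have i2 : Integrable (fun x => f x * h x) (μ s) :=
      (hf s).integrable_mul (h.memLp_of_isFiniteMeasure 2 _)
    have i3 : Integrable (fun x => |H| * (δ * (1 + f x ^ 2))) (μ s) :=
      ((((integrable_const 1).add (hfsq s)).const_mul δ).const_mul |H|)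
    rw [← integral_sub i1 i2, ← Real.norm_eq_abs]
    refine (norm_integral_le_of_norm_le i3 (Eventually.of_forall fun x => ?_)).trans ?_
    · rw [← sub_mul, norm_mul, mul_comm, Real.norm_eq_abs, Real.norm_eq_abs]
      exact mul_le_mul ((hH x).trans (le_abs_self H)) (hg x) (abs_nonneg _) (abs_nonneg _)
    · rw [integral_const_mul, integral_const_mul, integral_add (integrable_const 1) (hfsq s)]
      refine le_trans ?_ hHδ
      gcongr
      simp
      linarith
  have hc : ContinuousAt (fun s => ∫ x, (g₀ * h) x ∂μ s) t :=
    (hasDerivAt_integral_simpleFunc (hLi t) hμ (g₀ * h)).continuousAt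
  refine ⟨δ, hδ0, ?_⟩
  filter_upwards [hD, hh, Metric.continuousAt_iff'.1 hc (η / 8) (by positivity)]
    with s h1 h2 h3 g hg hg'
  have h1' := hD.self_of_nhds
  -- Six errors of at most `η/8` along the chain `∫ g L s dμ s`, `∫ g h dμ s`, `∫ f h dμ s`, `∫ g₀ h
  -- dμ s`, `∫ g₀ h dμ t`, `∫ f h dμ t`, `∫ f L t dμ t`.
  have e1 := cs s h1 h2 g (g.memLp_of_isFiniteMeasure 2 _) hg
  have e2 := ap s h1 g hg'
  have e3 := ap s h1 g₀ hg₀'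
  have e4 := ap t h1' g₀ hg₀'
  have e5 := cs t h1' hh.self_of_nhds f (hf t) fun x => by simp
  rw [Real.dist_eq] at h3
  simp only [SimpleFunc.coe_mul, Pi.mul_apply] at h3
  rw [abs_le] at *
  rw [abs_lt] at h3
  constructor <;> linarith

/-- Differentiation under the integral sign for a curve of probability measures with square
integrable scores `L` of continuous Fisher norm, and a function with locally bounded second
moments. -/
theorem hasDerivAt_integral_of_continuousAt_integral_sq {t : ℝ}
    (hL : ∀ s, MemLp (L s) 2 (μ s))
    (hμ : ∀ A, MeasurableSet A → ∀ s,
      HasDerivAt (fun s => (μ s).real A) (∫ x in A, L s x ∂μ s) s)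
    (hv : ∀ A, MeasurableSet A → ContinuousAt (fun s => ∫ x in A, L s x ∂μ s) t)
    (hn : ContinuousAt (fun s => ∫ x, L s x * L s x ∂μ s) t)
    {f : 𝒳 → ℝ} (hfm : Measurable f) (hf : ∀ s, MemLp f 2 (μ s)) {D : ℝ}
    (hD : ∀ᶠ s in 𝓝 t, ∫ x, f x ^ 2 ∂μ s ≤ D) :
    HasDerivAt (fun s => ∫ x, f x ∂μ s) (∫ x, f x * L t x ∂μ t) t := by
  have hLi : ∀ s, Integrable (L s) (μ s) := fun s => (hL s).integrable (by norm_num)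
  have hfi : ∀ s, Integrable f (μ s) := fun s => (hf s).integrable (by norm_num)
  have hfsq : ∀ s, Integrable (fun x => f x ^ 2) (μ s) := fun s => (hf s).integrable_sq
  have hD0 : 0 ≤ D := (integral_nonneg fun x => sq_nonneg _).trans hD.self_of_nhds
  set G := ∫ x, f x * L t x ∂μ t with hG
  rw [hasDerivAt_iff_isLittleO, Asymptotics.isLittleO_iff]
  intro η hη
  obtain ⟨δ, hδ, hev⟩ := eventually_abs_integral_mul_sub_le hL (fun A hA => hμ A hA t) hv hn
    hfm hf hD hη
  obtain ⟨r, hr, hball⟩ := Metric.eventually_nhds_iff_ball.1 (hev.and hD)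
  filter_upwards [Metric.ball_mem_nhds t hr] with s hs
  have ht : t ∈ Metric.ball t r := Metric.mem_ball_self hr
  simp only [smul_eq_mul, Real.norm_eq_abs]
  -- The ball is fixed before `g` is chosen, so `ε` can tend to zero with `s` held fixed.
  have approx : ∀ ε > 0, ∃ g : SimpleFunc 𝒳 ℝ,
      |∫ x, g x ∂μ s - ∫ x, g x ∂μ t - (s - t) * G| ≤ η * |s - t| ∧
      ∀ u ∈ Metric.ball t r, |∫ x, g x ∂μ u - ∫ x, f x ∂μ u| ≤ ε * (1 + D) := by
    intro ε hε
    obtain ⟨g, hg, hg'⟩ := exists_simpleFunc_abs_sub_le hfm (lt_min hε hδ)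
    refine ⟨g, ?_, fun u hu => ?_⟩
    -- After subtracting `u * G` the derivative is at most `η` in absolute value on the ball, and
    -- the mean value inequality applies.
    · have hder : ∀ u ∈ Metric.ball t r, HasDerivWithinAt (fun u => ∫ x, g x ∂μ u - u * G)
          (∫ x, g x * L u x ∂μ u - G) (Metric.ball t r) u := fun u _ => by
        have := (hasDerivAt_integral_simpleFunc (hLi u) (fun A hA => hμ A hA u) g).sub
          ((hasDerivAt_id u).mul_const G)
        rw [one_mul] at this
        exact this.hasDerivWithinAt
      have hb := (convex_ball t r).norm_image_sub_le_of_norm_hasDerivWithin_le hder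
        (C := η) (fun u hu => (hball u hu).1 g hg fun x => (hg' x).trans <| by
          gcongr; exact min_le_right _ _) ht hs
      simp only [Real.norm_eq_abs] at hb
      convert hb using 2
      ring
    · have i3 : Integrable (fun x => ε * (1 + f x ^ 2)) (μ u) :=
        (((integrable_const 1).add (hfsq u)).const_mul ε)
      rw [← integral_sub (SimpleFunc.integrable_of_isFiniteMeasure _) (hfi u),
        ← Real.norm_eq_abs]
      refine (norm_integral_le_of_norm_le i3 (Eventually.of_forall fun x => ?_)).trans ?_
      · refine (hg' x).trans ?_
        gcongr
        exact min_le_left _ _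
      · rw [integral_const_mul, integral_add (integrable_const 1) (hfsq u)]
        have := (hball u hu).2
        gcongr
        simp
  refine le_of_forall_pos_le_add fun ε hε => ?_
  obtain ⟨g, h1, h2⟩ := approx (ε / (2 * (1 + D))) (by positivity)
  have h3 := h2 s hs
  have h4 := h2 t ht
  have h5 : ε / (2 * (1 + D)) * (1 + D) = ε / 2 := by field_simp
  rw [h5] at h3 h4
  rw [abs_le] at h1 h3 h4 ⊢
  constructor <;> linarith

/-- A function that is a.e. strongly measurable for each measure of a setwise continuous curve
has a common measurable version. -/
theorem exists_measurable_forall_ae_eq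
    (hμ : ∀ A, MeasurableSet A → Continuous fun s => (μ s).real A) {f : 𝒳 → ℝ}
    (hf : ∀ s, AEStronglyMeasurable f (μ s)) :
    ∃ g : 𝒳 → ℝ, Measurable g ∧ ∀ s, f =ᵐ[μ s] g := by
  -- The countable sum over rational times dominates every `μ s`: a continuous `s ↦ μ s A` that
  -- vanishes on the rationals vanishes identically.
  have hsum : AEStronglyMeasurable f (Measure.sum fun q : ℚ => μ q) :=
    aestronglyMeasurable_sum_measure_iff.2 fun q => hf q
  refine ⟨hsum.mk f, hsum.stronglyMeasurable_mk.measurable, fun s => ?_⟩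
  refine Measure.AbsolutelyContinuous.ae_eq (Measure.AbsolutelyContinuous.mk fun A hA h0 => ?_)
    hsum.ae_eq_mk
  rw [Measure.sum_apply_eq_zero] at h0
  have : (fun s => (μ s).real A) = fun _ => 0 := by
    refine Continuous.ext_on Rat.denseRange_cast (hμ A hA) continuous_const ?_
    rintro _ ⟨q, rfl⟩
    simp [measureReal_def, h0 q]
  have h1 := congrFun this s
  simpa [measureReal_def, ENNReal.toReal_eq_zero_iff] using h1

end Curve

end MeasureTheory

namespace MeasureTheory.SignedMeasure

variable {𝒳 : Type*} [MeasurableSpace 𝒳]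

/-- Evaluation on a set is continuous for the total variation norm. -/
def evalCLM (A : Set 𝒳) : SignedMeasure 𝒳 →L[ℝ] ℝ :=
  LinearMap.mkContinuous
    { toFun := fun s => s A, map_add' := fun s t => by simp, map_smul' := fun a s => by simp } 1
    (fun s => by
      rw [one_mul]
      exact (SignedMeasure.norm_le_totalVariation s A).trans
        (ENNReal.toReal_mono (measure_ne_top _ _) (measure_mono (subset_univ A))))

end MeasureTheory.SignedMeasure

theorem contDiff_euclideanSpace_single {n : WithTop ℕ∞} :
    ContDiff ℝ n fun t : ℝ => EuclideanSpace.single (0 : Fin 1) t := by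
  have : (fun t : ℝ => EuclideanSpace.single (0 : Fin 1) t) =
      fun t : ℝ => t • EuclideanSpace.single (0 : Fin 1) (1 : ℝ) := by
    ext t i
    simp
  rw [this]
  fun_prop

/-! ### Curves of a diffeology. -/

namespace CkDiffeology

variable {k : ℕ∞} {X : Type*} {D : CkDiffeology k X}

/-- Tangent cones only use velocities at time `0`; translation brings every other time there. -/
theorem IsCurve.comp_const_add {c : ℝ → X} (hc : D.IsCurve c) (t : ℝ) :
    D.IsCurve fun s => c (t + s) := by
  have h : ContDiffOn ℝ k (fun x : EuclideanSpace ℝ (Fin 1) => EuclideanSpace.single 0 t + x) univ :=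
    (contDiff_const.add contDiff_id).contDiffOn
  have := D.comp hc isOpen_univ h (mapsTo_univ _ _)
  refine D.congr this fun x _ => ?_
  simp

theorem IsCurve.continuous {c : ℝ → X} (hc : D.IsCurve c) :
    @Continuous _ _ _ D.dTopology c := by
  refine @Continuous.mk _ _ _ D.dTopology _ fun s hs => ?_
  have h := hs 1 univ _ hc
  rw [univ_inter] at h
  convert h.preimage (contDiff_euclideanSpace_single (n := 0)).continuous using 1
  ext t
  simp

end CkDiffeology

/-! ### Velocities and scores of curves in the model. -/

namespace DiffeologicalStatisticalModel

variable {k : ℕ∞} {𝒳 : Type*} [MeasurableSpace 𝒳] {M : DiffeologicalStatisticalModel k 𝒳}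

theorem setIntegral_logRep (ξ : M.carrier) {v : SignedMeasure 𝒳} (hv : v ∈ M.tangentSpace ξ)
    {A : Set 𝒳} (hA : MeasurableSet A) : ∫ x in A, logRep ξ v x ∂(meas ξ) = v A := by
  have hac : v ≪ᵥ (meas ξ).toENNRealVectorMeasure := by
    intro B hB
    -- Domination is required on all sets; a vector measure is zero on nonmeasurable ones by
    -- convention.
    by_cases hBm : MeasurableSet B
    · rw [Measure.toENNRealVectorMeasure_apply_measurable hBm] at hB
      exact M.apply_eq_zero_of_mem_tangentSpace ξ hv hBm hB
    · exact v.not_measurable hBm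
  rw [logRep, ← withDensityᵥ_apply (SignedMeasure.integrable_rnDeriv _ _) hA]
  exact congrArg (fun w : SignedMeasure 𝒳 => w A)
    (SignedMeasure.withDensityᵥ_rnDeriv_eq v (meas ξ) hac)

theorem toSigned_apply (ξ : M.carrier) {A : Set 𝒳} (hA : MeasurableSet A) :
    toSigned ξ.1 A = (meas ξ).real A :=
  Measure.toSignedMeasure_apply_measurable hA

theorem contDiff_curve {c : ℝ → M.carrier} (hc : M.diffeology.IsCurve c) :
    ContDiff ℝ k fun t => toSigned (c t).1 := by
  have h := contDiffOn_univ.1 (M.contDiffOn_plot hc)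
  convert h.comp contDiff_euclideanSpace_single using 1
  ext t
  simp

theorem hasDerivAt_curve (hk : 1 ≤ k) {c : ℝ → M.carrier} (hc : M.diffeology.IsCurve c) (t : ℝ) :
    HasDerivAt (fun t => toSigned (c t).1) (deriv (fun t => toSigned (c t).1) t) t :=
  ((contDiff_curve hc).differentiable (by
    simpa using (zero_lt_one.trans_le hk).ne') t).hasDerivAt

/-- Makes 2-integrability available for the score at every time, not only at `0`. -/
theorem deriv_curve_mem_tangentCone (hk : 1 ≤ k) {c : ℝ → M.carrier}
    (hc : M.diffeology.IsCurve c) (t : ℝ) :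
    deriv (fun t => toSigned (c t).1) t ∈ M.tangentCone (c t) := by
  refine ⟨fun s => c (t + s), hc.comp_const_add t, by simp, ?_⟩
  have h : HasDerivAt (fun t => toSigned (c t).1) (deriv (fun t => toSigned (c t).1) t) (t + 0) := by
    simpa only [add_zero] using hasDerivAt_curve hk hc t
  exact h.comp_const_add t 0

theorem continuous_deriv_curve (hk : 1 ≤ k) {c : ℝ → M.carrier} (hc : M.diffeology.IsCurve c) :
    Continuous (deriv fun t => toSigned (c t).1) :=
  (contDiff_curve hc).continuous_deriv (by exact_mod_cast hk)

/-- The squared Fisher norm of the velocity of a curve in a 2-integrable model is continuous. -/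
theorem Is2Integrable.continuous_fisherMetric_deriv (hM : M.Is2Integrable) (hk : 1 ≤ k)
    {c : ℝ → M.carrier} (hc : M.diffeology.IsCurve c) :
    Continuous fun t => M.fisherMetric (c t) (deriv (fun t => toSigned (c t).1) t)
      (deriv (fun t => toSigned (c t).1) t) := by
  have h := hM.continuousOn_norm 1 univ _ hc
  rw [univ_prod_univ, continuousOn_univ] at h
  -- Pull the norm on the tangent bundle back along the unit vector field of the line, then square.
  have h2 : Continuous fun t : ℝ =>
      (EuclideanSpace.single (0 : Fin 1) t, EuclideanSpace.single (0 : Fin 1) (1 : ℝ)) :=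
    (contDiff_euclideanSpace_single (n := 0)).continuous.prodMk continuous_const
  have h3 := (h.comp h2).pow 2
  convert h3 using 1
  funext t
  have hd : fderiv ℝ (fun x : EuclideanSpace ℝ (Fin 1) => toSigned (c (x 0)).1)
      (EuclideanSpace.single 0 t) (EuclideanSpace.single 0 1) =
      deriv (fun t => toSigned (c t).1) t := by
    have h4 : HasFDerivAt (fun x : EuclideanSpace ℝ (Fin 1) => x 0)
        (EuclideanSpace.proj (0 : Fin 1) : EuclideanSpace ℝ (Fin 1) →L[ℝ] ℝ)
        (EuclideanSpace.single 0 t) :=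
      (EuclideanSpace.proj (0 : Fin 1) : EuclideanSpace ℝ (Fin 1) →L[ℝ] ℝ).hasFDerivAt
    have h5 := hasDerivAt_curve hk hc ((EuclideanSpace.single (0 : Fin 1) t) 0)
    have h6 := (h5.hasFDerivAt.comp (EuclideanSpace.single (0 : Fin 1) t) h4).fderiv
    simp only [Function.comp_def] at h6
    rw [h6]
    simp
  simp only [Pi.pow_apply, Function.comp_apply, hd, PiLp.single_apply, if_true]
  rw [Real.sq_sqrt]
  exact integral_nonneg fun x => mul_self_nonneg _

/-- Differentiation of expectations along curves in a 2-integrable model. -/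
theorem Is2Integrable.hasDerivAt_integral (hM : M.Is2Integrable) (hk : 1 ≤ k) {f : 𝒳 → ℝ}
    (hf : ∀ ξ : M.carrier, MemLp f 2 (meas ξ)) {c : ℝ → M.carrier} (hc : M.diffeology.IsCurve c)
    {C : NNReal} (hC : ∀ᶠ ξ in @nhds M.carrier M.diffeology.dTopology (c 0),
      eLpNorm f 2 (meas ξ) ≤ C)
    {v : SignedMeasure 𝒳} (hv : HasVelocity c v) :
    HasDerivAt (fun t => ∫ x, f x ∂(meas (c t)))
      (∫ x, f x * logRep (c 0) v x ∂(meas (c 0))) 0 := by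
  set w := deriv fun t => toSigned (c t).1 with hw
  have hwt : ∀ t, w t ∈ M.tangentSpace (c t) := fun t =>
    Submodule.subset_span (deriv_curve_mem_tangentCone hk hc t)
  obtain rfl : w 0 = v := hv.deriv
  have hμ : ∀ A, MeasurableSet A → ∀ s, HasDerivAt (fun s => (meas (c s)).real A)
      (∫ x in A, logRep (c s) (w s) x ∂(meas (c s))) s := by
    intro A hA s
    rw [setIntegral_logRep _ (hwt s) hA]
    have := (SignedMeasure.evalCLM A).hasFDerivAt.comp_hasDerivAt s (hasDerivAt_curve hk hc s)
    exact this.congr_of_eventuallyEq (Eventually.of_forall fun t => (toSigned_apply (c t) hA).symm)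
  -- `f` is only a.e. measurable for each measure separately, whereas the simple approximations must
  -- serve all times at once.
  obtain ⟨g, hgm, hg⟩ := exists_measurable_forall_ae_eq (μ := fun t => meas (c t)) (f := f)
    (fun A hA => continuous_iff_continuousAt.2 fun s => (hμ A hA s).continuousAt)
    fun s => (hf (c s)).aestronglyMeasurable
  have hgL : ∀ s, MemLp g 2 (meas (c s)) := fun s => (hf (c s)).ae_eq (hg s)
  have hgD : ∀ᶠ s in 𝓝 (0 : ℝ), ∫ x, g x ^ 2 ∂(meas (c s)) ≤ (C : ℝ) ^ 2 := by
    have htend : Tendsto c (𝓝 0) (@nhds M.carrier M.diffeology.dTopology (c 0)) :=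
      @Continuous.tendsto _ _ _ M.diffeology.dTopology _ hc.continuous 0
    filter_upwards [htend.eventually hC] with s hs
    rw [eLpNorm_congr_ae (hg s)] at hs
    have h1 : (eLpNorm g 2 (meas (c s))).toReal ≤ C := ENNReal.toReal_le_coe_of_le_coe hs
    have h0 : 0 ≤ ∫ x, g x ^ 2 ∂(meas (c s)) := integral_nonneg fun x => sq_nonneg _
    have h2 : ∫ x, g x ^ 2 ∂(meas (c s)) = (eLpNorm g 2 (meas (c s))).toReal ^ 2 := by
      rw [(hgL s).eLpNorm_eq_integral_rpow_norm (by simp) (by simp),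
        ENNReal.toReal_ofReal (by positivity)]
      simp only [ENNReal.toReal_ofNat, Real.rpow_ofNat, Real.norm_eq_abs, sq_abs]
      rw [← Real.rpow_natCast, ← Real.rpow_mul h0]
      norm_num
    rw [h2]
    gcongr
  have key := hasDerivAt_integral_of_continuousAt_integral_sq (μ := fun t => meas (c t))
    (L := fun t => logRep (c t) (w t)) (t := 0)
    (fun s => hM.almost _ _ (deriv_curve_mem_tangentCone hk hc s)) hμ
    (fun A hA => by
      simp_rw [fun s => setIntegral_logRep (c s) (hwt s) hA]
      exact ((SignedMeasure.evalCLM A).continuous.comp (continuous_deriv_curve hk hc)).continuousAt)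
    (hM.continuous_fisherMetric_deriv hk hc).continuousAt hgm hgL hgD
  have e1 : ∀ t, ∫ x, f x ∂(meas (c t)) = ∫ x, g x ∂(meas (c t)) :=
    fun t => integral_congr_ae (hg t)
  have e2 : ∫ x, f x * logRep (c 0) (w 0) x ∂(meas (c 0)) =
      ∫ x, g x * logRep (c 0) (w 0) x ∂(meas (c 0)) :=
    integral_congr_ae ((hg 0).mul .rfl)
  simp_rw [e1]
  rw [e2]
  exact key

/-- Curves determine the functional on the tangent cone, linearity on its span, and density with
continuity on the completion. -/
theorem HasDifferentialAt.unique (hM : M.IsAlmost2Integrable) {f : M.carrier → ℝ} {ξ : M.carrier}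
    {α β : StrongDual ℝ (fisherCompletion hM ξ)} (hα : HasDifferentialAt hM f ξ α)
    (hβ : HasDifferentialAt hM f ξ β) : α = β := by
  have h : ∀ v : M.tangentSpace ξ, α (toCompletion hM ξ v) = β (toCompletion hM ξ v) := by
    rintro ⟨v, hv⟩
    induction hv using Submodule.span_induction with
    | mem v hv =>
      obtain ⟨c, hc, h0, hcv⟩ := hv
      exact (hα c ⟨v, _⟩ hc h0 hcv).unique (hβ c ⟨v, _⟩ hc h0 hcv)
    | zero => exact ((map_zero (α.toLinearMap ∘ₗ toCompletion hM ξ)).trans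
        (map_zero (β.toLinearMap ∘ₗ toCompletion hM ξ)).symm)
    | add v w hv hw h1 h2 =>
      have e : (⟨v + w, add_mem hv hw⟩ : M.tangentSpace ξ) = ⟨v, hv⟩ + ⟨w, hw⟩ := rfl
      rw [e, map_add, map_add, map_add, h1, h2]
    | smul a v hv h1 =>
      have e : (⟨a • v, Submodule.smul_mem _ a hv⟩ : M.tangentSpace ξ) = a • ⟨v, hv⟩ := rfl
      rw [e, map_smul, map_smul, map_smul, h1]
  exact DFunLike.coe_injective ((denseRange_toCompletion hM ξ).equalizer α.continuous β.continuous
    (funext h))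

/-! ### The centred estimator and its projection. -/

section Estimator

variable {V : Type*} [AddCommGroup V] [Module ℝ V] [TopologicalSpace V]

theorem memLp_sub_meanValue {φ : M.carrier → V} {σ : 𝒳 → M.carrier} (hσ : MemL2 φ σ)
    (ξ : M.carrier) (l : StrongDual ℝ V) :
    MemLp (fun x => l (φ (σ x)) - meanValue φ σ l ξ) 2 (meas ξ) :=
  (hσ ξ l).sub (memLp_const _)

/-- The centred estimator `l ↦ l ∘ φ ∘ σ - 𝔼_ξ(l ∘ φ ∘ σ)` as a linear map into `L²(𝒳, ξ)`. -/
def centredEstimator {φ : M.carrier → V} {σ : 𝒳 → M.carrier} (hσ : MemL2 φ σ) (ξ : M.carrier) :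
    StrongDual ℝ V →ₗ[ℝ] Lp ℝ 2 (meas ξ) where
  toFun l := (memLp_sub_meanValue hσ ξ l).toLp _
  map_add' l m := by
    rw [← MemLp.toLp_add]
    refine MemLp.toLp_congr _ _ (Eventually.of_forall fun x => ?_)
    have : meanValue φ σ (l + m) ξ = meanValue φ σ l ξ + meanValue φ σ m ξ :=
      integral_add ((hσ ξ l).integrable (by norm_num)) ((hσ ξ m).integrable (by norm_num))
    simp only [Pi.add_apply, add_apply, this]
    ring
  map_smul' a l := by
    rw [RingHom.id_apply, ← MemLp.toLp_const_smul]
    refine MemLp.toLp_congr _ _ (Eventually.of_forall fun x => ?_)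
    have : meanValue φ σ (a • l) ξ = a * meanValue φ σ l ξ := integral_const_mul _ _
    simp only [Pi.smul_apply, smul_apply, this, smul_eq_mul]
    ring

theorem inner_centredEstimator {φ : M.carrier → V} {σ : 𝒳 → M.carrier} (hσ : MemL2 φ σ)
    (ξ : M.carrier) (l m : StrongDual ℝ V) :
    inner ℝ (centredEstimator hσ ξ l) (centredEstimator hσ ξ m) = varianceForm φ σ ξ l m := by
  rw [L2.inner_def]
  refine integral_congr_ae ?_
  filter_upwards [(memLp_sub_meanValue hσ ξ l).coeFn_toLp,
    (memLp_sub_meanValue hσ ξ m).coeFn_toLp] with x hl hm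
  change inner ℝ ((memLp_sub_meanValue hσ ξ l).toLp _ x) ((memLp_sub_meanValue hσ ξ m).toLp _ x) = _
  rw [hl, hm]
  simp [mul_comm]

/-- The projection of the centred estimator to the completed tangent space represents the
differential of the mean value. -/
theorem Is2Integrable.hasDifferentialAt_meanValue (hM : M.Is2Integrable) (hk : 1 ≤ k)
    {φ : M.carrier → V} {σ : 𝒳 → M.carrier} (hσ : MemL2 φ σ) (hreg : IsRegular φ σ)
    (ξ : M.carrier) (l : StrongDual ℝ V) :
    HasDifferentialAt hM.almost (meanValue φ σ l) ξ
      (InnerProductSpace.toDual ℝ (fisherCompletion hM.almost ξ)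
        ((fisherCompletion hM.almost ξ).orthogonalProjectionOnto (centredEstimator hσ ξ l))) := by
  rintro c v hc rfl hv
  obtain ⟨C, hC⟩ := hreg l (c 0)
  refine (hM.hasDerivAt_integral hk (fun ξ => hσ ξ l) hc hC hv).congr_deriv (Eq.symm ?_)
  have hL := memLp_logRep hM.almost (c 0) v
  -- The score lies in the subspace, so the projection drops out of the pairing.
  rw [InnerProductSpace.toDual_apply_apply, Submodule.inner_orthogonalProjectionOnto_eq_of_mem_right]
  change inner ℝ (centredEstimator hσ (c 0) l) (logL2 hM.almost (c 0) v) = _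
  have h1 : inner ℝ (centredEstimator hσ (c 0) l) (logL2 hM.almost (c 0) v) =
      ∫ x, (l (φ (σ x)) * logRep (c 0) v.1 x -
        meanValue φ σ l (c 0) * logRep (c 0) v.1 x) ∂(meas (c 0)) := by
    rw [L2.inner_def]
    refine integral_congr_ae ?_
    filter_upwards [(memLp_sub_meanValue hσ (c 0) l).coeFn_toLp, hL.coeFn_toLp] with x h1 h2
    change inner ℝ ((memLp_sub_meanValue hσ (c 0) l).toLp _ x) (hL.toLp _ x) = _
    rw [h1, h2, ← sub_mul]
    simp [mul_comm]
  -- The total mass is constantly `1`, so scores have mean zero and centring does not change the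
  -- pairing.
  have h2 : ∫ x, logRep (c 0) v.1 x ∂(meas (c 0)) = 0 := by
    rw [← setIntegral_univ, setIntegral_logRep _ v.2 MeasurableSet.univ]
    have h3 := (SignedMeasure.evalCLM univ).hasFDerivAt.comp_hasDerivAt (0 : ℝ) hv
    refine h3.unique ((hasDerivAt_const (0 : ℝ) (1 : ℝ)).congr_of_eventuallyEq
      (Eventually.of_forall fun t => ?_))
    exact (toSigned_apply (c t) MeasurableSet.univ).trans (by simp)
  rw [h1, integral_sub (by exact (hσ (c 0) l).integrable_mul hL)
    ((hL.integrable (by norm_num)).const_mul _), integral_const_mul, h2, mul_zero, sub_zero]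

/-- `differential` is a choice; uniqueness identifies it with the Riesz dual of the projection. -/
theorem Is2Integrable.inverseFisherForm_eq (hM : M.Is2Integrable) (hk : 1 ≤ k)
    {φ : M.carrier → V} {σ : 𝒳 → M.carrier} (hσ : MemL2 φ σ) (hreg : IsRegular φ σ)
    (ξ : M.carrier) (l m : StrongDual ℝ V) :
    inverseFisherForm hM.almost φ σ ξ l m =
      inner ℝ ((fisherCompletion hM.almost ξ).orthogonalProjectionOnto (centredEstimator hσ ξ l))
        ((fisherCompletion hM.almost ξ).orthogonalProjectionOnto (centredEstimator hσ ξ m)) := by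
  have hd : ∀ l, differential hM.almost (meanValue φ σ l) ξ =
      InnerProductSpace.toDual ℝ (fisherCompletion hM.almost ξ)
        ((fisherCompletion hM.almost ξ).orthogonalProjectionOnto (centredEstimator hσ ξ l)) := by
    intro l
    have h := hM.hasDifferentialAt_meanValue hk hσ hreg ξ l
    have hex : ∃ α, HasDifferentialAt hM.almost (meanValue φ σ l) ξ α := ⟨_, h⟩
    rw [differential, dif_pos hex]
    exact HasDifferentialAt.unique hM.almost hex.choose_spec h
  rw [inverseFisherForm, inverseFisher, hd, hd, LinearIsometryEquiv.symm_apply_apply,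
    LinearIsometryEquiv.symm_apply_apply]

end Estimator

end DiffeologicalStatisticalModel

theorem mainTheorem3 {𝒳 : Type*} [MeasurableSpace 𝒳] {k : ℕ∞} (hk : 1 ≤ k)
    (M : DiffeologicalStatisticalModel k 𝒳) (hM : M.Is2Integrable)
    {V : Type*} [AddCommGroup V] [Module ℝ V] [TopologicalSpace V] [IsTopologicalAddGroup V]
    [ContinuousSMul ℝ V] [LocallyConvexSpace ℝ V]
    (φ : M.carrier → V) (σ : 𝒳 → M.carrier)
    (hσ : DiffeologicalStatisticalModel.MemL2 φ σ)
    (hreg : DiffeologicalStatisticalModel.IsRegular φ σ)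
    (ξ : M.carrier) :
    (∀ l : StrongDual ℝ V, ∃! α,
      DiffeologicalStatisticalModel.HasDifferentialAt hM.almost
        (DiffeologicalStatisticalModel.meanValue φ σ l) ξ α) ∧
    ∃ B : LinearMap.BilinForm ℝ (StrongDual ℝ V),
      (∀ l m : StrongDual ℝ V,
        B l m = DiffeologicalStatisticalModel.varianceForm φ σ ξ l m -
          DiffeologicalStatisticalModel.inverseFisherForm hM.almost φ σ ξ l m) ∧
      B.IsPosSemidef := by
  refine ⟨fun l => ⟨_, hM.hasDifferentialAt_meanValue hk hσ hreg ξ l, fun β hβ =>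
    hβ.unique hM.almost (hM.hasDifferentialAt_meanValue hk hσ hreg ξ l)⟩, ?_⟩
  set T := DiffeologicalStatisticalModel.fisherCompletion hM.almost ξ
  set X := DiffeologicalStatisticalModel.centredEstimator hσ ξ
  -- A difference of two Gram forms pulled back along linear maps, so bilinearity is built in.
  refine ⟨(innerₗ (Lp ℝ 2 (DiffeologicalStatisticalModel.meas ξ))).compl₁₂ X X -
    (innerₗ T).compl₁₂ (T.orthogonalProjectionOnto.toLinearMap ∘ₗ X)
      (T.orthogonalProjectionOnto.toLinearMap ∘ₗ X), fun l m => ?_, ⟨⟨fun l m => ?_⟩, ⟨fun l => ?_⟩⟩⟩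
  · rw [hM.inverseFisherForm_eq hk hσ hreg,
      ← DiffeologicalStatisticalModel.inner_centredEstimator hσ]
    rfl
  · change inner ℝ (X l) (X m) - inner ℝ (T.orthogonalProjectionOnto (X l))
      (T.orthogonalProjectionOnto (X m)) = inner ℝ (X m) (X l) -
      inner ℝ (T.orthogonalProjectionOnto (X m)) (T.orthogonalProjectionOnto (X l))
    rw [real_inner_comm (X m), real_inner_comm (T.orthogonalProjectionOnto (X m))]
  · change 0 ≤ inner ℝ (X l) (X l) - inner ℝ (T.orthogonalProjectionOnto (X l))
      (T.orthogonalProjectionOnto (X l))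
    rw [real_inner_self_eq_norm_sq, real_inner_self_eq_norm_sq, sub_nonneg]
    gcongr
    exact T.norm_orthogonalProjectionOnto_apply_le (X l)

end
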